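/- Let $L$ be a Lie algebra over an arbitrary field. Write $A(n)$ for the abelian Lie algebra of dimension $n$. Call $L$ a generalized Heisenberg Lie algebra of rank $m$ if $L^2=Z(L)$ and $\dim L^2=m$, where $L^2=[L,L]$, and call $L$ $d$-generator if $d$ is the minimal number of elements that generate $L$. Let $L\otimes L$ be the non-abelian tensor square, i.e. the Lie algebra generated by symbols $x\otimes y$ $(x,y\in L)$, bilinear in $(x,y)$, subject to $$[x,x']\otimes y=x\otimes[x',y]-x'\otimes[x,y],\quad x\otimes[y,y']=[y',x]\otimes y-[y,x]\otimes y',\quad [x\otimes y,x'\otimes y']=-[y,x]\otimes[x',y'];$$ let $L\wedge L$ be its quotient by the ideal generated by all $x\otimes x$, and let $J_2(L)$ be the kernel of the commutator map $L\otimes L\to L^2$, $x\otimes y\mapsto[x,y]$. Let $L$ be a $d$-generator generalized Heisenberg Lie algebra of rank $m$. (i) If $m=\frac12d(d-1)-1$, then $$L\wedge L\cong A\big(\tfrac16(d-1)(2d^2+5d-6)-1\big),\quad L\otimes L\cong A\big(\tfrac13d(d^2+3d-4)\big),\quad J_2(L)\cong A\big(\tfrac16(d+1)(2d-3)(d+2)+2\big).$$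 (ii) If $m=\frac12d(d-1)-2$, then $$L\wedge L\cong A\big(\tfrac16(d-1)(2d^2+5d-12)-2\big),\quad L\otimes L\cong A\big(\tfrac13d(d^2+3d-7)\big),\quad J_2(L)\cong A\big(\tfrac16(d+1)(2d^2+d-12)+4\big).$$ (iii) If $m=\frac12d(d-1)-3$, then - $L\wedge L\cong A\big(\tfrac16(d-1)(2d^2+5d-18)-3\big)$ or $L\wedge L\cong A\big(\tfrac16(d-1)(2d^2+5d-18)-2\big)$; - $L\otimes L\cong A\big(\tfrac13d(d^2+3d-10)\big)$ or $L\otimes L\cong A\big(\tfrac13d(d^2+3d-10)+1\big)$; - $J_2(L)\cong A\big(\tfrac16(d+1)(2d^2+d-18)+6\big)$ or $J_2(L)\cong A\big(\tfrac16(d+1)(2d^2+d-18)+7\big)$. -/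

import Mathlib

/-- The number `d` of generators: `L` is generated, as a Lie algebra, by some `d` elements and by no
smaller finite set. -/
def IsGeneratedMinimallyBy (K L : Type*) [Field K] [LieRing L] [LieAlgebra K L] (d : ℕ) : Prop :=
  IsLeast {n : ℕ | ∃ s : Finset L, s.card = n ∧ LieSubalgebra.lieSpan K L (s : Set L) = ⊤} d

/-- `L` is a generalized Heisenberg Lie algebra of rank `m`: `L² = Z(L)` and `dim L² = m`. -/
def IsGeneralizedHeisenberg (K L : Type*) [Field K] [LieRing L] [LieAlgebra K L] (m : ℕ) : Prop :=
  ⁅(⊤ : LieIdeal K L), (⊤ : LieIdeal K L)⁆ = LieAlgebra.center K L ∧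
    Module.rank K ↥⁅(⊤ : LieIdeal K L), (⊤ : LieIdeal K L)⁆ = m

/-- `M ≅ A(q)`: `M` is an abelian Lie algebra of dimension `q`. The dimension is a rational number
so that formulas with divisions and subtractions can be written as they are; in particular `q` is
then a natural number and `M` is finite-dimensional. -/
def IsAbelianOfDim (K M : Type*) [Field K] [LieRing M] [LieAlgebra K M] (q : ℚ) : Prop :=
  IsLieAbelian M ∧ ∃ n : ℕ, (n : ℚ) = q ∧ Module.rank K M = n

section TensorSquare

variable (K L : Type*) [Field K] [LieRing L] [LieAlgebra K L]

/-- The symbol `x ⊗ y` in the free Lie algebra on the set of all pairs. -/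
noncomputable def tensorSymbol (x y : L) : FreeLieAlgebra K (L × L) :=
  FreeLieAlgebra.of K (x, y)

/-- The defining relations of the non-abelian tensor square, `L` acting on itself by the adjoint
action: each pair `(u, v)` below is a relation `u = v`. -/
inductive TensorSquareRel : FreeLieAlgebra K (L × L) → FreeLieAlgebra K (L × L) → Prop
  | smul_left (c : K) (x y : L) :
      TensorSquareRel (tensorSymbol K L (c • x) y) (c • tensorSymbol K L x y)
  | smul_right (c : K) (x y : L) :
      TensorSquareRel (tensorSymbol K L x (c • y)) (c • tensorSymbol K L x y)
  | add_left (x x' y : L) :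
      TensorSquareRel (tensorSymbol K L (x + x') y) (tensorSymbol K L x y + tensorSymbol K L x' y)
  | add_right (x y y' : L) :
      TensorSquareRel (tensorSymbol K L x (y + y')) (tensorSymbol K L x y + tensorSymbol K L x y')
  | lie_left (x x' y : L) :
      TensorSquareRel (tensorSymbol K L ⁅x, x'⁆ y)
        (tensorSymbol K L x ⁅x', y⁆ - tensorSymbol K L x' ⁅x, y⁆)
  | lie_right (x y y' : L) :
      TensorSquareRel (tensorSymbol K L x ⁅y, y'⁆)
        (tensorSymbol K L ⁅y', x⁆ y - tensorSymbol K L ⁅y, x⁆ y')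
  | lie_lie (x y x' y' : L) :
      TensorSquareRel ⁅tensorSymbol K L x y, tensorSymbol K L x' y'⁆
        (-tensorSymbol K L ⁅y, x⁆ ⁅x', y'⁆)

/-- The ideal of relations. -/
noncomputable def tensorSquareIdeal : LieIdeal K (FreeLieAlgebra K (L × L)) :=
  LieSubmodule.lieSpan K (FreeLieAlgebra K (L × L))
    {w | ∃ u v, TensorSquareRel K L u v ∧ w = u - v}

/-- The non-abelian tensor square `L ⊗ L`. -/
abbrev LieTensorSquare : Type _ :=
  FreeLieAlgebra K (L × L) ⧸ tensorSquareIdeal K L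

/-- The element `x ⊗ y` of `L ⊗ L`. -/
noncomputable def lieTmul (x y : L) : LieTensorSquare K L :=
  LieSubmodule.Quotient.mk (tensorSymbol K L x y)

/-- The ideal `L □ L` of `L ⊗ L` generated by all `x ⊗ x`. -/
noncomputable def boxSquare : LieIdeal K (LieTensorSquare K L) :=
  LieSubmodule.lieSpan K (LieTensorSquare K L) {w | ∃ x : L, w = lieTmul K L x x}

/-- The non-abelian exterior square `L ∧ L = (L ⊗ L) / (L □ L)`. -/
abbrev LieExteriorSquare : Type _ :=
  LieTensorSquare K L ⧸ boxSquare K L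

/-- The commutator map on the free Lie algebra, `x ⊗ y ↦ [x, y]`. -/
noncomputable def freeCommutatorMap : FreeLieAlgebra K (L × L) →ₗ⁅K⁆ L :=
  FreeLieAlgebra.lift K fun p : L × L => ⁅p.1, p.2⁆

theorem freeCommutatorMap_symbol (x y : L) :
    freeCommutatorMap K L (tensorSymbol K L x y) = ⁅x, y⁆ :=
  FreeLieAlgebra.lift_of_apply (R := K) (fun p : L × L => ⁅p.1, p.2⁆) (x, y)

theorem freeCommutatorMap_eq_of_rel {u v : FreeLieAlgebra K (L × L)}
    (h : TensorSquareRel K L u v) : freeCommutatorMap K L u = freeCommutatorMap K L v := by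
  cases h with
  | smul_left c x y => simp [freeCommutatorMap_symbol]
  | smul_right c x y => simp [freeCommutatorMap_symbol]
  | add_left x x' y => simp [freeCommutatorMap_symbol]
  | add_right x y y' => simp [freeCommutatorMap_symbol]
  | lie_left x x' y => simp [freeCommutatorMap_symbol]
  | lie_right x y y' =>
    simp only [freeCommutatorMap_symbol, map_sub]
    rw [leibniz_lie x y y', ← lie_skew x y, ← lie_skew ⁅y', x⁆ y, ← lie_skew x y', lie_neg, neg_lie]
    abel
  | lie_lie x y x' y' =>
    simp only [LieHom.map_lie, map_neg, freeCommutatorMap_symbol]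
    rw [← lie_skew x y, neg_lie]

theorem tensorSquareIdeal_le_ker : tensorSquareIdeal K L ≤ (freeCommutatorMap K L).ker := by
  refine LieSubmodule.lieSpan_le.2 ?_
  rintro _ ⟨u, v, h, rfl⟩
  simp [LieHom.mem_ker, freeCommutatorMap_eq_of_rel K L h]

/-- The commutator map `κ : L ⊗ L → L`, `x ⊗ y ↦ [x, y]`, whose image is `L²`. -/
noncomputable def commutatorMap : LieTensorSquare K L →ₗ⁅K⁆ L :=
  { (tensorSquareIdeal K L).toSubmodule.liftQ (freeCommutatorMap K L : _ →ₗ[K] L)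
      (fun _ hw => LinearMap.mem_ker.2 (LieHom.mem_ker.1 (tensorSquareIdeal_le_ker K L hw))) with
    map_lie' := by
      intro u v
      induction u using Submodule.Quotient.induction_on
      induction v using Submodule.Quotient.induction_on
      exact LieHom.map_lie (freeCommutatorMap K L) _ _ }

theorem commutatorMap_tmul (x y : L) : commutatorMap K L (lieTmul K L x y) = ⁅x, y⁆ :=
  freeCommutatorMap_symbol K L x y

/-- `J₂(L)`, the kernel of the commutator map. -/
noncomputable abbrev J₂ : LieIdeal K (LieTensorSquare K L) :=
  (commutatorMap K L).ker

end TensorSquare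

/-!
Let `Z = L² = Z(L)` and let `V` be a linear complement of `Z`, so that `dim V = d` and the bracket
of `L = V × Z` is an alternating bilinear map `B : V × V → Z` whose values span `Z`
(`ClassTwoSplitting`, `exists_classTwoSplitting`).

Since `L` has class two, the symbols `x ⊗ y` commute in `L ⊗ L`, which is therefore an abelian Lie
algebra: the vector space `L ⊗_K L` modulo the two relations for `[x, x'] ⊗ y` and
`x ⊗ [y, y']`. In it `Z ⊗ Z` vanishes, `z ⊗ v = - v ⊗ z`, and what is left of the relations is the
Jacobi identity, so that (`ClassTwoSplitting.tensorSquareEquiv`)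
`L ⊗ L ≅ (V ⊗ V) × (V ⊗ Z) / J`, where `J` is spanned by the elements
`x ⊗ B(y, z) - y ⊗ B(x, z) + z ⊗ B(x, y)`. Under this isomorphism `L □ L` is the span of the
`v ⊗ v`, whose quotient in `V ⊗ V` is `⋀²V`, and `J₂(L)` has codimension `m`. This works in every
characteristic.

It remains to find `dim J`. The subspace `J` is the image of a map `⋀³V → V ⊗ Z`; its kernel
consists of the trivectors all of whose slices (contractions with linear forms) lie in
`R = ker (⋀²V → Z)`, where `dim R = d(d-1)/2 - m`. If a trivector `c` has a nonzero coordinate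
`c(f, g, h)`, then its slices along `f`, `g`, `h` are multiples of the unit vectors in the
coordinates `(g, h)`, `(h, f)`, `(f, g)`; so these coordinates map `R` onto `K³`
(`kerWedgeCoords_surjective`). Hence the kernel is zero if `dim R ≤ 2`. If `dim R = 3`, the three
coordinates are injective on `R`, a trivector `c'` in the kernel is determined by `c'(f, g, h)`, and
the kernel has dimension at most one; this is the source of the two alternatives for
`m = d(d-1)/2 - 3`.
-/

open scoped TensorProduct

/-! ### Trivectors and the Jacobi map -/

section LinearAlgebra

variable {K V N : Type*} [Field K] [AddCommGroup V] [Module K V] [AddCommGroup N] [Module K N]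

/-- The Jacobi map `(x, y, z) ↦ x ⊗ β(y, z) - y ⊗ β(x, z) + z ⊗ β(x, y)` of an alternating
bilinear map `β`. -/
noncomputable def AlternatingMap.jacobi (β : V [⋀^Fin 2]→ₗ[K] N) : V [⋀^Fin 3]→ₗ[K] V ⊗[K] N :=
  AlternatingMap.alternatizeUncurryFin
    { toFun := fun x => (TensorProduct.mk K V N x).compAlternatingMap β
      map_add' := fun x y => by ext v; simp
      map_smul' := fun c x => by ext v; simp [TensorProduct.smul_tmul'] }

theorem AlternatingMap.jacobi_apply (β : V [⋀^Fin 2]→ₗ[K] N) (v : Fin 3 → V) :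
    β.jacobi v =
      v 0 ⊗ₜ β ![v 1, v 2] - v 1 ⊗ₜ β ![v 0, v 2] + v 2 ⊗ₜ β ![v 0, v 1] := by
  have h0 : Fin.removeNth 0 v = ![v 1, v 2] := by
    ext i; fin_cases i <;> rfl
  have h1 : Fin.removeNth 1 v = ![v 0, v 2] := by
    ext i; fin_cases i <;> rfl
  have h2 : Fin.removeNth 2 v = ![v 0, v 1] := by
    ext i; fin_cases i <;> rfl
  rw [AlternatingMap.jacobi, AlternatingMap.alternatizeUncurryFin_apply]
  simp [Fin.sum_univ_three, h0, h1, h2, sub_eq_add_neg]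

/-- The map `⋀²V → N` induced by an alternating bilinear map. -/
noncomputable abbrev AlternatingMap.wedge (β : V [⋀^Fin 2]→ₗ[K] N) : ⋀[K]^2 V →ₗ[K] N :=
  exteriorPower.alternatingMapLinearEquiv β

/-- The map `⋀³V → V ⊗ N` induced by the Jacobi map. -/
noncomputable abbrev AlternatingMap.jacobiWedge (β : V [⋀^Fin 2]→ₗ[K] N) :
    ⋀[K]^3 V →ₗ[K] V ⊗[K] N :=
  exteriorPower.alternatingMapLinearEquiv β.jacobi

theorem AlternatingMap.range_jacobiWedge (β : V [⋀^Fin 2]→ₗ[K] N) :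
    LinearMap.range β.jacobiWedge = Submodule.span K (Set.range β.jacobi) := by
  rw [LinearMap.range_eq_map, ← exteriorPower.ιMulti_span, Submodule.map_span, ← Set.range_comp]
  congr 2
  ext v
  simp

/-- The contraction `⋀³V → ⋀²V` along a linear form. -/
noncomputable def trivectorSlice (f : Module.Dual K V) : ⋀[K]^3 V →ₗ[K] ⋀[K]^2 V :=
  (TensorProduct.lid K _).toLinearMap ∘ₗ LinearMap.rTensor _ f ∘ₗ
    (exteriorPower.ιMulti K 2).jacobiWedge

theorem AlternatingMap.wedge_trivectorSlice (β : V [⋀^Fin 2]→ₗ[K] N) (f : Module.Dual K V)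
    (c : ⋀[K]^3 V) :
    β.wedge (trivectorSlice f c) =
      TensorProduct.lid K N (LinearMap.rTensor N f (β.jacobiWedge c)) := by
  suffices h : β.wedge ∘ₗ trivectorSlice f =
      (TensorProduct.lid K N).toLinearMap ∘ₗ LinearMap.rTensor N f ∘ₗ β.jacobiWedge from
    LinearMap.congr_fun h c
  apply exteriorPower.linearMap_ext
  ext v
  simp [trivectorSlice, AlternatingMap.jacobi_apply, -exteriorPower.ιMulti_apply_coe]

theorem trivectorSlice_mem_ker {β : V [⋀^Fin 2]→ₗ[K] N} {c : ⋀[K]^3 V}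
    (hc : c ∈ LinearMap.ker β.jacobiWedge) (f : Module.Dual K V) :
    trivectorSlice f c ∈ LinearMap.ker β.wedge := by
  rw [LinearMap.mem_ker] at hc ⊢
  rw [AlternatingMap.wedge_trivectorSlice, hc, map_zero, map_zero]

/-- The coordinate of a bivector at a pair of linear forms. -/
noncomputable def bivectorCoord (f g : Module.Dual K V) : ⋀[K]^2 V →ₗ[K] K :=
  exteriorPower.pairingDual K V 2 (exteriorPower.ιMulti K 2 ![f, g])

/-- The coordinate of a trivector at a triple of linear forms. -/
noncomputable def trivectorCoord (f g h : Module.Dual K V) : ⋀[K]^3 V →ₗ[K] K :=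
  exteriorPower.pairingDual K V 3 (exteriorPower.ιMulti K 3 ![f, g, h])

theorem bivectorCoord_trivectorSlice (f g h : Module.Dual K V) (c : ⋀[K]^3 V) :
    bivectorCoord g h (trivectorSlice f c) = trivectorCoord f g h c := by
  suffices H : bivectorCoord g h ∘ₗ trivectorSlice f = trivectorCoord f g h from
    LinearMap.congr_fun H c
  apply exteriorPower.linearMap_ext
  ext v
  simp [trivectorSlice, AlternatingMap.jacobi_apply, bivectorCoord, trivectorCoord,
    Matrix.det_fin_two, Matrix.det_fin_three, -exteriorPower.ιMulti_apply_coe]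
  ring

theorem trivectorCoord_swap_left (f g h : Module.Dual K V) (c : ⋀[K]^3 V) :
    trivectorCoord g f h c = -trivectorCoord f g h c := by
  suffices H : trivectorCoord g f h = -trivectorCoord f g h from LinearMap.congr_fun H c
  apply exteriorPower.linearMap_ext
  ext v
  simp [trivectorCoord, Matrix.det_fin_three, -exteriorPower.ιMulti_apply_coe]
  ring

theorem trivectorCoord_swap_right (f g h : Module.Dual K V) (c : ⋀[K]^3 V) :
    trivectorCoord f h g c = -trivectorCoord f g h c := by
  suffices H : trivectorCoord f h g = -trivectorCoord f g h from LinearMap.congr_fun H c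
  apply exteriorPower.linearMap_ext
  ext v
  simp [trivectorCoord, Matrix.det_fin_three, -exteriorPower.ιMulti_apply_coe]
  ring

theorem trivectorCoord_self_right (f g : Module.Dual K V) (c : ⋀[K]^3 V) :
    trivectorCoord f g g c = 0 := by
  suffices H : trivectorCoord f g g = 0 from LinearMap.congr_fun H c
  apply exteriorPower.linearMap_ext
  ext v
  simp [trivectorCoord, Matrix.det_fin_three, -exteriorPower.ιMulti_apply_coe]

theorem trivectorCoord_self_left (f g : Module.Dual K V) (c : ⋀[K]^3 V) :
    trivectorCoord f f g c = 0 := by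
  rw [← neg_eq_zero, ← trivectorCoord_swap_right, ← neg_eq_zero, ← trivectorCoord_swap_left,
    trivectorCoord_self_right]

theorem trivectorCoord_self_outer (f g : Module.Dual K V) (c : ⋀[K]^3 V) :
    trivectorCoord f g f c = 0 := by
  rw [← neg_eq_zero, ← trivectorCoord_swap_right, trivectorCoord_self_left]

theorem eq_zero_of_trivectorCoord_eq_zero {c : ⋀[K]^3 V}
    (hc : ∀ f g h : Module.Dual K V, trivectorCoord f g h c = 0) : c = 0 := by
  classical
  have ⟨I, b⟩ := Module.Free.exists_basis K V
  let : LinearOrder I := linearOrderOfSTO WellOrderingRel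
  refine (b.exteriorPower 3).ext_elem_iff.2 fun s => ?_
  rw [map_zero, Finsupp.zero_apply, exteriorPower.basis_repr_apply]
  refine Eq.trans ?_ (hc (b.coord (Set.powersetCard.ofFinEmbEquiv.symm s 0))
    (b.coord (Set.powersetCard.ofFinEmbEquiv.symm s 1))
    (b.coord (Set.powersetCard.ofFinEmbEquiv.symm s 2)))
  rw [exteriorPower.ιMultiDual, trivectorCoord, exteriorPower.ιMulti_family]
  congr 3

theorem LinearMap.injective_of_surjective_of_finrank_le {E F : Type*} [AddCommGroup E] [Module K E]
    [AddCommGroup F] [Module K F] [FiniteDimensional K E] {f : E →ₗ[K] F}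
    (hf : Function.Surjective f) (h : Module.finrank K E ≤ Module.finrank K F) :
    Function.Injective f := by
  have := Module.Finite.of_surjective f hf
  exact (LinearMap.injective_iff_surjective_of_finrank_eq_finrank
    (h.antisymm (LinearMap.finrank_le_finrank_of_surjective hf))).2 hf

section Kernel

variable {β : V [⋀^Fin 2]→ₗ[K] N}

/-- The coordinates of the elements of `ker (⋀²V → N)` at the three pairs of a triple of
linear forms. -/
noncomputable def kerWedgeCoords (β : V [⋀^Fin 2]→ₗ[K] N) (f g h : Module.Dual K V) :
    LinearMap.ker β.wedge →ₗ[K] Fin 3 → K :=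
  LinearMap.pi ![bivectorCoord g h, bivectorCoord h f, bivectorCoord f g] ∘ₗ Submodule.subtype _

theorem kerWedgeCoords_slice {f g h : Module.Dual K V} {c : ⋀[K]^3 V}
    (hc : c ∈ LinearMap.ker β.jacobiWedge) (l : Module.Dual K V) :
    kerWedgeCoords β f g h ⟨trivectorSlice l c, trivectorSlice_mem_ker hc l⟩ =
      ![trivectorCoord l g h c, trivectorCoord l h f c, trivectorCoord l f g c] := by
  ext i
  fin_cases i <;> simp [kerWedgeCoords, bivectorCoord_trivectorSlice]

/-- A trivector in the kernel of the Jacobi map, with a nonzero coordinate at `(f, g, h)`, provides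
elements of `ker (⋀²V → N)` with arbitrary coordinates at `(g, h)`, `(h, f)`, `(f, g)`. -/
theorem kerWedgeCoords_surjective {f g h : Module.Dual K V} {c : ⋀[K]^3 V}
    (hc : c ∈ LinearMap.ker β.jacobiWedge) (h0 : trivectorCoord f g h c ≠ 0) :
    Function.Surjective (kerWedgeCoords β f g h) := by
  -- the slices of `c` along `f`, `g`, `h` map to the same multiple of the three unit vectors
  have h1 : trivectorCoord g h f c = trivectorCoord f g h c := by
    rw [trivectorCoord_swap_right, trivectorCoord_swap_left, neg_neg]
  have h2 : trivectorCoord h f g c = trivectorCoord f g h c := by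
    rw [trivectorCoord_swap_left, trivectorCoord_swap_right, neg_neg]
  intro t
  refine ⟨(trivectorCoord f g h c)⁻¹ •
    (t 0 • ⟨trivectorSlice f c, trivectorSlice_mem_ker hc f⟩ +
      t 1 • ⟨trivectorSlice g c, trivectorSlice_mem_ker hc g⟩ +
      t 2 • ⟨trivectorSlice h c, trivectorSlice_mem_ker hc h⟩), ?_⟩
  simp only [map_smul, map_add, kerWedgeCoords_slice hc, trivectorCoord_self_left,
    trivectorCoord_self_outer, h1, h2]
  ext i
  fin_cases i <;> simp <;> field_simp

variable [FiniteDimensional K V]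

/-- The slices of a nonzero trivector span a space of dimension at least three. -/
theorem three_le_finrank_ker_wedge {c : ⋀[K]^3 V} (hc : c ∈ LinearMap.ker β.jacobiWedge)
    (h0 : c ≠ 0) : 3 ≤ Module.finrank K (LinearMap.ker β.wedge) := by
  contrapose! h0
  refine eq_zero_of_trivectorCoord_eq_zero fun f g h => ?_
  contrapose! h0
  have := LinearMap.finrank_le_finrank_of_surjective (kerWedgeCoords_surjective hc h0)
  simpa using this

/-- If `ker (⋀²V → N)` has dimension at most three, then an element of the kernel of the Jacobi map
is determined by a single coordinate at which that kernel does not vanish. -/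
theorem eq_zero_of_trivectorCoord_eq_zero_of_finrank_le
    (hβ : Module.finrank K (LinearMap.ker β.wedge) ≤ 3)
    {f g h : Module.Dual K V} {c c' : ⋀[K]^3 V}
    (hc : c ∈ LinearMap.ker β.jacobiWedge) (h0 : trivectorCoord f g h c ≠ 0)
    (hc' : c' ∈ LinearMap.ker β.jacobiWedge) (h0' : trivectorCoord f g h c' = 0) : c' = 0 := by
  have hs := kerWedgeCoords_surjective hc h0
  have hi : Function.Injective (kerWedgeCoords β f g h) :=
    LinearMap.injective_of_surjective_of_finrank_le (E := LinearMap.ker β.wedge) hs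
      (hβ.trans (Module.finrank_fin_fun K).ge)
  -- a slice is determined by its coordinates at `(g, h)`, `(h, f)`, `(f, g)`
  have key : ∀ l : Module.Dual K V, trivectorCoord l g h c' = 0 → trivectorCoord l h f c' = 0 →
      trivectorCoord l f g c' = 0 → trivectorSlice l c' = 0 := by
    intro l e0 e1 e2
    have := kerWedgeCoords_slice (f := f) (g := g) (h := h) hc' l
    rw [e0, e1, e2] at this
    have h3 : (⟨trivectorSlice l c', trivectorSlice_mem_ker hc' l⟩ : LinearMap.ker β.wedge) = 0 :=
      hi (by rw [this, map_zero]; ext i; fin_cases i <;> rfl)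
    exact congrArg Subtype.val h3
  have h1 : trivectorCoord g h f c' = 0 := by
    rw [trivectorCoord_swap_right, trivectorCoord_swap_left, neg_neg, h0']
  have h2 : trivectorCoord h f g c' = 0 := by
    rw [trivectorCoord_swap_left, trivectorCoord_swap_right, neg_neg, h0']
  have sf := key f h0' (trivectorCoord_self_outer ..) (trivectorCoord_self_left ..)
  have sg := key g (trivectorCoord_self_left ..) h1 (trivectorCoord_self_outer ..)
  have sh := key h (trivectorCoord_self_outer ..) (trivectorCoord_self_left ..) h2
  -- the slices along `f`, `g`, `h` vanish, hence so does every coordinate with one of these entries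
  have slot : ∀ {p : Module.Dual K V}, trivectorSlice p c' = 0 → ∀ l q : Module.Dual K V,
      trivectorCoord l p q c' = 0 := by
    intro p hp l q
    rw [trivectorCoord_swap_left, ← bivectorCoord_trivectorSlice, hp, map_zero, neg_zero]
  refine eq_zero_of_trivectorCoord_eq_zero fun l p q => ?_
  rw [← bivectorCoord_trivectorSlice, key l (slot sg _ _) (slot sh _ _) (slot sf _ _), map_zero]

theorem finrank_ker_jacobiWedge_eq_zero
    (hβ : Module.finrank K (LinearMap.ker β.wedge) ≤ 2) :
    Module.finrank K (LinearMap.ker β.jacobiWedge) = 0 := by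
  rw [Submodule.finrank_eq_zero, Submodule.eq_bot_iff]
  intro c hc
  by_contra h0
  have := three_le_finrank_ker_wedge hc h0
  omega

theorem finrank_ker_jacobiWedge_le_one
    (hβ : Module.finrank K (LinearMap.ker β.wedge) ≤ 3) :
    Module.finrank K (LinearMap.ker β.jacobiWedge) ≤ 1 := by
  by_cases H : ∃ c ∈ LinearMap.ker β.jacobiWedge, ∃ f g h, trivectorCoord f g h c ≠ 0
  · obtain ⟨c, hc, f, g, h, h0⟩ := H
    have hi : Function.Injective
        (trivectorCoord f g h ∘ₗ (LinearMap.ker β.jacobiWedge).subtype) := by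
      rw [injective_iff_map_eq_zero]
      intro x hx
      exact Subtype.ext (eq_zero_of_trivectorCoord_eq_zero_of_finrank_le hβ hc h0 x.2 hx)
    simpa using LinearMap.finrank_le_finrank_of_injective hi
  · push Not at H
    have : LinearMap.ker β.jacobiWedge = ⊥ :=
      (Submodule.eq_bot_iff _).2 fun c hc => eq_zero_of_trivectorCoord_eq_zero (H c hc)
    rw [this, finrank_bot]
    exact zero_le

end Kernel

section Dimension

variable [FiniteDimensional K V] (β : V [⋀^Fin 2]→ₗ[K] N)

theorem finrank_ker_wedge_add (hβ : Function.Surjective β.wedge) :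
    Module.finrank K (LinearMap.ker β.wedge) + Module.finrank K N =
      (Module.finrank K V).choose 2 := by
  rw [← exteriorPower.finrank_eq, ← β.wedge.finrank_range_add_finrank_ker,
    LinearMap.range_eq_top.2 hβ, finrank_top, add_comm]

theorem finrank_quotient_range_jacobiWedge_add [FiniteDimensional K N] :
    Module.finrank K ((V ⊗[K] N) ⧸ LinearMap.range β.jacobiWedge) +
        (Module.finrank K V).choose 3 =
      Module.finrank K V * Module.finrank K N +
        Module.finrank K (LinearMap.ker β.jacobiWedge) := by
  have h1 := β.jacobiWedge.finrank_range_add_finrank_ker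
  have h2 := (LinearMap.range β.jacobiWedge).finrank_quotient_add_finrank
  rw [exteriorPower.finrank_eq] at h1
  rw [Module.finrank_tensorProduct] at h2
  omega

end Dimension

/-! ### Alternating bilinear maps and diagonal tensors -/

section Bilinear

/-- A bilinear map vanishing on the diagonal, as an alternating map in two variables. -/
def LinearMap.toAlternating (B : V →ₗ[K] V →ₗ[K] N) (hB : ∀ x, B x x = 0) :
    V [⋀^Fin 2]→ₗ[K] N where
  toFun v := B (v 0) (v 1)
  map_update_add' v i x y := by
    fin_cases i <;> simp [Function.update]
  map_update_smul' v i c x := by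
    fin_cases i <;> simp [Function.update]
  map_eq_zero_of_eq' v i j h hij := by
    fin_cases i <;> fin_cases j <;> simp_all

@[simp]
theorem LinearMap.toAlternating_apply (B : V →ₗ[K] V →ₗ[K] N) (hB : ∀ x, B x x = 0)
    (v : Fin 2 → V) : B.toAlternating hB v = B (v 0) (v 1) :=
  rfl

theorem LinearMap.wedge_toAlternating_surjective {B : V →ₗ[K] V →ₗ[K] N} (hB : ∀ x, B x x = 0)
    (hspan : Submodule.span K (Set.range fun p : V × V => B p.1 p.2) = ⊤) :
    Function.Surjective (B.toAlternating hB).wedge := by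
  rw [← LinearMap.range_eq_top, eq_top_iff, ← hspan, Submodule.span_le]
  rintro _ ⟨p, rfl⟩
  exact ⟨exteriorPower.ιMulti K 2 ![p.1, p.2], by simp [-exteriorPower.ιMulti_apply_coe]⟩

theorem update_pair_zero {α : Type*} (x y z : α) : Function.update ![x, y] 0 z = ![z, y] := by
  ext i; fin_cases i <;> rfl

theorem update_pair_one {α : Type*} (x y z : α) : Function.update ![x, y] 1 z = ![x, z] := by
  ext i; fin_cases i <;> rfl

variable (K V)

/-- The canonical map `V ⊗ V → ⋀²V`. -/
noncomputable def tensorToWedge : V ⊗[K] V →ₗ[K] ⋀[K]^2 V :=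
  TensorProduct.lift <| LinearMap.mk₂ K (fun x y => exteriorPower.ιMulti K 2 ![x, y])
    (fun x x' y => by
      simpa only [update_pair_zero, update_pair_one] using
        (exteriorPower.ιMulti K 2).map_update_add ![x, y] 0 x x')
    (fun c x y => by
      simpa only [update_pair_zero, update_pair_one] using
        (exteriorPower.ιMulti K 2).map_update_smul ![x, y] 0 c x)
    (fun x y y' => by
      simpa only [update_pair_zero, update_pair_one] using
        (exteriorPower.ιMulti K 2).map_update_add ![x, y] 1 y y')
    (fun c x y => by
      simpa only [update_pair_zero, update_pair_one] using
        (exteriorPower.ιMulti K 2).map_update_smul ![x, y] 1 c y)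

/-- The span of the tensors `v ⊗ v`. -/
def diagonalTensors : Submodule K (V ⊗[K] V) :=
  Submodule.span K (Set.range fun v : V => v ⊗ₜ[K] v)

variable {K V}

@[simp]
theorem tensorToWedge_tmul (x y : V) :
    tensorToWedge K V (x ⊗ₜ y) = exteriorPower.ιMulti K 2 ![x, y] :=
  rfl

theorem tensorToWedge_surjective : Function.Surjective (tensorToWedge K V) := by
  rw [← LinearMap.range_eq_top, eq_top_iff, ← exteriorPower.ιMulti_span, Submodule.span_le]
  rintro _ ⟨v, rfl⟩
  refine ⟨v 0 ⊗ₜ v 1, ?_⟩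
  rw [tensorToWedge_tmul]
  congr 1
  ext i
  fin_cases i <;> rfl

/-- In every characteristic the tensors `v ⊗ v` span the kernel of `V ⊗ V → ⋀²V`. -/
theorem ker_tensorToWedge : LinearMap.ker (tensorToWedge K V) = diagonalTensors K V := by
  apply le_antisymm
  · -- `V ⊗ V → (V ⊗ V) / ⟨v ⊗ v⟩` is alternating, hence factors through `⋀²V`
    let q : ⋀[K]^2 V →ₗ[K] (V ⊗[K] V) ⧸ diagonalTensors K V :=
      (((TensorProduct.mk K V V).compr₂ (diagonalTensors K V).mkQ).toAlternating fun x => by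
        exact (Submodule.Quotient.mk_eq_zero _).2 (Submodule.subset_span ⟨x, rfl⟩)).wedge
    have hq : q ∘ₗ tensorToWedge K V = (diagonalTensors K V).mkQ := by
      ext x y
      simp [q, -exteriorPower.ιMulti_apply_coe]
      rfl
    intro t ht
    rw [← (diagonalTensors K V).ker_mkQ, LinearMap.mem_ker, ← hq, LinearMap.comp_apply,
      LinearMap.mem_ker.1 ht, map_zero]
  · rw [diagonalTensors, Submodule.span_le]
    rintro _ ⟨v, rfl⟩
    exact (exteriorPower.ιMulti K 2).map_eq_zero_of_eq ![v, v] (i := 0) (j := 1) rfl (by simp)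

theorem finrank_diagonalTensors_add [FiniteDimensional K V] :
    Module.finrank K (diagonalTensors K V) + (Module.finrank K V).choose 2 =
      Module.finrank K V * Module.finrank K V := by
  have h := (tensorToWedge K V).finrank_range_add_finrank_ker
  rw [LinearMap.range_eq_top.2 tensorToWedge_surjective, finrank_top, ker_tensorToWedge,
    exteriorPower.finrank_eq, Module.finrank_tensorProduct] at h
  omega

end Bilinear

end LinearAlgebra

/-! ### The non-abelian tensor square in class two -/

section Presentation

variable {K L : Type*} [Field K] [LieRing L] [LieAlgebra K L]

theorem mk_eq_mk_of_tensorSquareRel {u v : FreeLieAlgebra K (L × L)}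
    (h : TensorSquareRel K L u v) :
    (LieSubmodule.Quotient.mk u : LieTensorSquare K L) = LieSubmodule.Quotient.mk v :=
  (Submodule.Quotient.eq _).2 (LieSubmodule.subset_lieSpan ⟨u, v, h, rfl⟩)

variable (K L) in
/-- The bilinear map `(x, y) ↦ x ⊗ y` into the non-abelian tensor square. -/
noncomputable def lieTmulBilin : L →ₗ[K] L →ₗ[K] LieTensorSquare K L :=
  LinearMap.mk₂ K (lieTmul K L)
    (fun x x' y => mk_eq_mk_of_tensorSquareRel (.add_left x x' y))
    (fun c x y => mk_eq_mk_of_tensorSquareRel (.smul_left c x y))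
    (fun x y y' => mk_eq_mk_of_tensorSquareRel (.add_right x y y'))
    (fun c x y => mk_eq_mk_of_tensorSquareRel (.smul_right c x y))

theorem lieTmulBilin_apply (x y : L) : lieTmulBilin K L x y = lieTmul K L x y :=
  rfl

theorem lieTmulBilin_lie_left (x x' y : L) :
    lieTmulBilin K L ⁅x, x'⁆ y = lieTmulBilin K L x ⁅x', y⁆ - lieTmulBilin K L x' ⁅x, y⁆ :=
  mk_eq_mk_of_tensorSquareRel (.lie_left x x' y)

theorem lieTmulBilin_lie_right (x y y' : L) :
    lieTmulBilin K L x ⁅y, y'⁆ = lieTmulBilin K L ⁅y', x⁆ y - lieTmulBilin K L ⁅y, x⁆ y' :=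
  mk_eq_mk_of_tensorSquareRel (.lie_right x y y')

theorem lie_lieTmulBilin (x y x' y' : L) :
    ⁅lieTmulBilin K L x y, lieTmulBilin K L x' y'⁆ = -lieTmulBilin K L ⁅y, x⁆ ⁅x', y'⁆ :=
  mk_eq_mk_of_tensorSquareRel (.lie_lie x y x' y')

/-- A Lie subalgebra of `L ⊗ L` that contains all `x ⊗ y` is everything. -/
theorem lieTensorSquare_subalgebra_eq_top (S : LieSubalgebra K (LieTensorSquare K L))
    (hS : ∀ x y, lieTmul K L x y ∈ S) : S = ⊤ := by
  let q : FreeLieAlgebra K (L × L) →ₗ⁅K⁆ LieTensorSquare K L :=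
    { toLinearMap := (tensorSquareIdeal K L).toSubmodule.mkQ
      map_lie' := rfl }
  have hq : S.incl.comp (FreeLieAlgebra.lift K fun p : L × L => (⟨_, hS p.1 p.2⟩ : S)) = q := by
    ext p
    simp only [LieHom.comp_apply, FreeLieAlgebra.lift_of_apply]
    rfl
  rw [eq_top_iff]
  intro w _
  induction w using Submodule.Quotient.induction_on with
  | H w =>
    change q w ∈ S
    rw [← hq]
    exact Subtype.property _

theorem lieTmulBilin_lie_of_central (a b : L) {z : L} (hz : ∀ x : L, ⁅x, z⁆ = 0) :
    lieTmulBilin K L ⁅a, b⁆ z = 0 := by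
  rw [lieTmulBilin_lie_left, hz, hz, map_zero, map_zero, sub_zero]

theorem lie_eq_zero_of_mem_span_symbols
    (hcl : ∀ a b c : L, ⁅a, ⁅b, c⁆⁆ = 0)
    {u v : LieTensorSquare K L}
    (hu : u ∈ Submodule.span K (Set.range fun p : L × L => lieTmulBilin K L p.1 p.2))
    (hv : v ∈ Submodule.span K (Set.range fun p : L × L => lieTmulBilin K L p.1 p.2)) :
    ⁅u, v⁆ = 0 := by
  induction hu, hv using Submodule.span_induction₂ with
  | mem_mem u v hu hv =>
    obtain ⟨p, rfl⟩ := hu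
    obtain ⟨q, rfl⟩ := hv
    simp only [lie_lieTmulBilin]
    rw [lieTmulBilin_lie_of_central _ _ fun x => hcl x _ _, neg_zero]
  | zero_left => exact zero_lie _
  | zero_right => exact lie_zero _
  | add_left _ _ _ _ _ _ h h' => rw [add_lie, h, h', add_zero]
  | add_right _ _ _ _ _ _ h h' => rw [lie_add, h, h', add_zero]
  | smul_left _ _ _ _ _ h => rw [smul_lie, h, smul_zero]
  | smul_right _ _ _ _ _ h => rw [lie_smul, h, smul_zero]

/-- If `L` has class at most two, the symbols `x ⊗ y` commute, so that their linear span is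
already the whole non-abelian tensor square. -/
theorem span_lieTmulBilin_eq_top (hcl : ∀ a b c : L, ⁅a, ⁅b, c⁆⁆ = 0) :
    Submodule.span K (Set.range fun p : L × L => lieTmulBilin K L p.1 p.2) = ⊤ := by
  let S : LieSubalgebra K (LieTensorSquare K L) :=
    { Submodule.span K (Set.range fun p : L × L => lieTmulBilin K L p.1 p.2) with
      lie_mem' := fun {u v} hu hv => by
        rw [lie_eq_zero_of_mem_span_symbols hcl hu hv]
        exact Submodule.zero_mem _ }
  have hS : S = ⊤ :=
    lieTensorSquare_subalgebra_eq_top S fun x y => Submodule.subset_span ⟨(x, y), rfl⟩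
  rw [eq_top_iff]
  intro w _
  change w ∈ S
  rw [hS]
  exact LieSubalgebra.mem_top w

theorem lieTensorSquare_lie_eq_zero (hcl : ∀ a b c : L, ⁅a, ⁅b, c⁆⁆ = 0)
    (u v : LieTensorSquare K L) : ⁅u, v⁆ = 0 :=
  lie_eq_zero_of_mem_span_symbols hcl (span_lieTmulBilin_eq_top (K := K) hcl ▸ Submodule.mem_top)
    (span_lieTmulBilin_eq_top (K := K) hcl ▸ Submodule.mem_top)

theorem lieTensorSquare_linearMap_ext (hcl : ∀ a b c : L, ⁅a, ⁅b, c⁆⁆ = 0)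
    {M : Type*} [AddCommGroup M] [Module K M] {F G : LieTensorSquare K L →ₗ[K] M}
    (h : ∀ x y, F (lieTmulBilin K L x y) = G (lieTmulBilin K L x y)) : F = G := by
  refine LinearMap.ext_on (span_lieTmulBilin_eq_top hcl) ?_
  rintro _ ⟨p, rfl⟩
  exact h p.1 p.2

/-- The universal property of `L ⊗ L` with respect to vector spaces, regarded as abelian Lie
algebras. -/
theorem exists_lieTensorSquare_linearMap {M : Type*} [AddCommGroup M] [Module K M]
    (f : L →ₗ[K] L →ₗ[K] M)
    (hl : ∀ x x' y : L, f ⁅x, x'⁆ y = f x ⁅x', y⁆ - f x' ⁅x, y⁆)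
    (hr : ∀ x y y' : L, f x ⁅y, y'⁆ = f ⁅y', x⁆ y - f ⁅y, x⁆ y')
    (h0 : ∀ x y x' y' : L, f ⁅x, y⁆ ⁅x', y'⁆ = 0) :
    ∃ F : LieTensorSquare K L →ₗ[K] M, ∀ x y, F (lieTmulBilin K L x y) = f x y := by
  let _ : LieRing M :=
    { bracket := fun _ _ => 0
      add_lie := fun _ _ _ => (add_zero 0).symm
      lie_add := fun _ _ _ => (add_zero 0).symm
      lie_self := fun _ => rfl
      leibniz_lie := fun _ _ _ => (add_zero 0).symm }
  let _ : LieAlgebra K M := { lie_smul := fun c _ _ => (smul_zero c).symm }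
  let φ : FreeLieAlgebra K (L × L) →ₗ⁅K⁆ M := FreeLieAlgebra.lift K fun p => f p.1 p.2
  have hφ : ∀ x y, φ (tensorSymbol K L x y) = f x y := fun x y =>
    FreeLieAlgebra.lift_of_apply (R := K) (fun p : L × L => f p.1 p.2) (x, y)
  have hle : tensorSquareIdeal K L ≤ φ.ker := by
    refine LieSubmodule.lieSpan_le.2 ?_
    rintro _ ⟨u, v, h, rfl⟩
    rw [SetLike.mem_coe, LieHom.mem_ker, map_sub, sub_eq_zero]
    cases h with
    | smul_left c x y => simp [hφ]
    | smul_right c x y => simp [hφ]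
    | add_left x x' y => simp [hφ]
    | add_right x y y' => simp [hφ]
    | lie_left x x' y => rw [map_sub, hφ, hφ, hφ, hl]
    | lie_right x y y' => rw [map_sub, hφ, hφ, hφ, hr]
    | lie_lie x y x' y' =>
      rw [map_neg, hφ, h0, neg_zero, LieHom.map_lie]
      rfl
  exact ⟨(tensorSquareIdeal K L).toSubmodule.liftQ (φ : FreeLieAlgebra K (L × L) →ₗ[K] M)
    fun w hw => LinearMap.mem_ker.2 (LieHom.mem_ker.1 (hle hw)), fun x y => hφ x y⟩

end Presentation

/-! ### The tensor square of a split central extension -/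

section Splitting

variable {K L V Z : Type*} [Field K] [LieRing L] [LieAlgebra K L] [AddCommGroup V] [Module K V]
  [AddCommGroup Z] [Module K Z]

/-- A splitting of `L` as a central extension: a linear bijection `V × Z → L` under which the
bracket is `[(v, z), (v', z')] = (0, B(v, v'))` for an alternating bilinear map `B` whose values
span `Z`. -/
structure ClassTwoSplitting (K L V Z : Type*) [Field K] [LieRing L] [LieAlgebra K L]
    [AddCommGroup V] [Module K V] [AddCommGroup Z] [Module K Z] where
  equiv : (V × Z) ≃ₗ[K] L
  form : V →ₗ[K] V →ₗ[K] Z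
  form_self : ∀ v, form v v = 0
  span_form : Submodule.span K (Set.range fun p : V × V => form p.1 p.2) = ⊤
  lie_equiv : ∀ p q, ⁅equiv p, equiv q⁆ = equiv (0, form p.1 q.1)

namespace ClassTwoSplitting

variable (S : ClassTwoSplitting K L V Z)

theorem lie_eq (x y : L) :
    ⁅x, y⁆ = S.equiv (0, S.form (S.equiv.symm x).1 (S.equiv.symm y).1) := by
  rw [← S.lie_equiv, LinearEquiv.apply_symm_apply, LinearEquiv.apply_symm_apply]

theorem symm_lie (x y : L) :
    S.equiv.symm ⁅x, y⁆ = (0, S.form (S.equiv.symm x).1 (S.equiv.symm y).1) := by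
  rw [S.lie_eq, LinearEquiv.symm_apply_apply]

include S in
theorem lie_lie_eq_zero (a b c : L) : ⁅a, ⁅b, c⁆⁆ = 0 := by
  rw [S.lie_eq, S.symm_lie, map_zero, Prod.mk_zero_zero, map_zero]

theorem form_swap (v w : V) : S.form v w = -S.form w v := by
  have := S.form_self (v + w)
  simp only [map_add, LinearMap.add_apply, S.form_self, zero_add, add_zero] at this
  exact eq_neg_of_add_eq_zero_right this

/-- The alternating map underlying the bracket. -/
abbrev alt : V [⋀^Fin 2]→ₗ[K] Z :=
  S.form.toAlternating S.form_self

theorem jacobi_eq (x y z : V) : S.alt.jacobi ![x, y, z] =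
    x ⊗ₜ S.form y z - y ⊗ₜ S.form x z + z ⊗ₜ S.form x y := by
  simp [AlternatingMap.jacobi_apply]

/-- The quotient of `V ⊗ Z` by the Jacobi relations
`x ⊗ [y, z] - y ⊗ [x, z] + z ⊗ [x, y] = 0`. -/
abbrev JacobiQuotient : Type _ :=
  (V ⊗[K] Z) ⧸ LinearMap.range S.alt.jacobiWedge

theorem mkQ_jacobi (x y z : V) :
    (LinearMap.range S.alt.jacobiWedge).mkQ
      (x ⊗ₜ S.form y z - y ⊗ₜ S.form x z + z ⊗ₜ S.form x y) = 0 := by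
  rw [← S.jacobi_eq, Submodule.mkQ_apply, Submodule.Quotient.mk_eq_zero,
    AlternatingMap.range_jacobiWedge]
  exact Submodule.subset_span ⟨_, rfl⟩

/-- The pairing `((v, z), (v', z')) ↦ (v ⊗ v', v ⊗ z' - v' ⊗ z)`. -/
noncomputable def pairing : L →ₗ[K] L →ₗ[K] (V ⊗[K] V) × S.JacobiQuotient :=
  let P : L →ₗ[K] V := LinearMap.fst K V Z ∘ₗ S.equiv.symm.toLinearMap
  let Q : L →ₗ[K] Z := LinearMap.snd K V Z ∘ₗ S.equiv.symm.toLinearMap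
  LinearMap.mk₂ K (fun x y => (P x ⊗ₜ P y,
      (LinearMap.range S.alt.jacobiWedge).mkQ (P x ⊗ₜ Q y - P y ⊗ₜ Q x)))
    (fun x x' y => by
      ext <;> simp only [map_add, TensorProduct.add_tmul, TensorProduct.tmul_add, map_sub,
        Prod.fst_add, Prod.snd_add]
      abel)
    (fun c x y => by
      ext <;> simp only [map_smul, ← TensorProduct.smul_tmul', TensorProduct.tmul_smul, map_sub,
        Prod.smul_fst, Prod.smul_snd, smul_sub])
    (fun x y y' => by
      ext <;> simp only [map_add, TensorProduct.add_tmul, TensorProduct.tmul_add, map_sub,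
        Prod.fst_add, Prod.snd_add]
      abel)
    (fun c x y => by
      ext <;> simp only [map_smul, ← TensorProduct.smul_tmul', TensorProduct.tmul_smul, map_sub,
        Prod.smul_fst, Prod.smul_snd, smul_sub])

theorem pairing_apply (x y : L) : S.pairing x y =
    ((S.equiv.symm x).1 ⊗ₜ (S.equiv.symm y).1,
      (LinearMap.range S.alt.jacobiWedge).mkQ ((S.equiv.symm x).1 ⊗ₜ (S.equiv.symm y).2 -
        (S.equiv.symm y).1 ⊗ₜ (S.equiv.symm x).2)) :=
  rfl

/-- The pairing respects the defining relations of `L ⊗ L`: both of them become the Jacobi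
relation. -/
theorem exists_toProd : ∃ F : LieTensorSquare K L →ₗ[K] (V ⊗[K] V) × S.JacobiQuotient,
    ∀ x y, F (lieTmulBilin K L x y) = S.pairing x y := by
  refine exists_lieTensorSquare_linearMap S.pairing ?_ ?_ ?_
  · intro x x' y
    simp only [S.pairing_apply, S.symm_lie]
    ext
    · simp
    · have := S.mkQ_jacobi (S.equiv.symm x).1 (S.equiv.symm x').1 (S.equiv.symm y).1
      simp only [TensorProduct.zero_tmul, TensorProduct.tmul_zero, sub_zero, zero_sub,
        Prod.snd_sub, map_neg, map_add, map_sub] at this ⊢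
      rw [eq_comm, ← sub_eq_zero, ← this]
      abel
  · intro x y y'
    simp only [S.pairing_apply, S.symm_lie]
    ext
    · simp
    · have := S.mkQ_jacobi (S.equiv.symm x).1 (S.equiv.symm y).1 (S.equiv.symm y').1
      rw [S.form_swap (S.equiv.symm y').1, S.form_swap (S.equiv.symm y).1 (S.equiv.symm x).1]
      simp only [TensorProduct.zero_tmul, sub_zero, zero_sub, Prod.snd_sub, map_add, map_sub,
        TensorProduct.tmul_neg, neg_neg] at this ⊢
      rw [← sub_eq_zero, ← this]
      abel
  · intro x y x' y'
    simp only [S.pairing_apply, S.symm_lie]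
    ext <;> simp

/-- The linear map `L ⊗ L → (V ⊗ V) × (V ⊗ Z) / Jacobi` given by the pairing. -/
noncomputable def toProd : LieTensorSquare K L →ₗ[K] (V ⊗[K] V) × S.JacobiQuotient :=
  S.exists_toProd.choose

theorem toProd_tmul (x y : L) : S.toProd (lieTmulBilin K L x y) = S.pairing x y :=
  S.exists_toProd.choose_spec x y

/-- The inclusion of `V` into `L`. -/
def inV : V →ₗ[K] L := S.equiv.toLinearMap ∘ₗ LinearMap.inl K V Z

/-- The inclusion of `Z` into `L`. -/
def inZ : Z →ₗ[K] L := S.equiv.toLinearMap ∘ₗ LinearMap.inr K V Z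

theorem lie_inV (x y : V) : ⁅S.inV x, S.inV y⁆ = S.inZ (S.form x y) :=
  S.lie_equiv _ _

theorem lie_inZ (x : L) (z : Z) : ⁅x, S.inZ z⁆ = 0 := by
  rw [S.lie_eq]
  simp [inZ]

theorem inV_add_inZ (x : L) : S.inV (S.equiv.symm x).1 + S.inZ (S.equiv.symm x).2 = x := by
  simp [inV, inZ, ← map_add]

theorem symm_inV (v : V) : S.equiv.symm (S.inV v) = (v, 0) := by
  simp [inV]

theorem symm_inZ (z : Z) : S.equiv.symm (S.inZ z) = (0, z) := by
  simp [inZ]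

/-- To verify a linear identity on `Z` it suffices to check it on brackets. -/
theorem linearMap_ext_form {M : Type*} [AddCommGroup M] [Module K M] {f g : Z →ₗ[K] M}
    (h : ∀ x y, f (S.form x y) = g (S.form x y)) : f = g := by
  refine LinearMap.ext_on S.span_form ?_
  rintro _ ⟨p, rfl⟩
  exact h p.1 p.2

theorem tmul_inZ_inZ (z w : Z) : lieTmulBilin K L (S.inZ z) (S.inZ w) = 0 := by
  suffices h : (lieTmulBilin K L).flip (S.inZ w) ∘ₗ S.inZ = 0 from LinearMap.congr_fun h z
  refine S.linearMap_ext_form fun x y => ?_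
  rw [LinearMap.comp_apply, LinearMap.flip_apply, ← lie_inV,
    lieTmulBilin_lie_of_central _ _ fun a => S.lie_inZ a w, LinearMap.zero_apply]

/-- The Jacobi relation holds in `L ⊗ L`: expand `z ⊗ [x, y]` by the relation for a bracket on the
right and the result by the relation for a bracket on the left. -/
theorem tmul_inV_inV_lie (x y z : V) :
    lieTmulBilin K L (S.inV x) (S.inZ (S.form y z)) -
      lieTmulBilin K L (S.inV y) (S.inZ (S.form x z)) +
      lieTmulBilin K L (S.inV z) (S.inZ (S.form x y)) = 0 := by
  have h := lieTmulBilin_lie_right (K := K) (S.inV z) (S.inV x) (S.inV y)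
  rw [lieTmulBilin_lie_left, lieTmulBilin_lie_left] at h
  simp only [lie_inV] at h
  rw [S.form_swap z x, S.form_swap z y, S.form_swap y x] at h
  simp only [map_neg] at h
  rw [← sub_eq_zero] at h
  rw [← neg_eq_zero, ← h]
  abel

theorem tmul_inZ_inV (z : Z) (v : V) :
    lieTmulBilin K L (S.inZ z) (S.inV v) = -lieTmulBilin K L (S.inV v) (S.inZ z) := by
  suffices h : (lieTmulBilin K L).flip (S.inV v) ∘ₗ S.inZ =
      -(lieTmulBilin K L (S.inV v) ∘ₗ S.inZ) from LinearMap.congr_fun h z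
  refine S.linearMap_ext_form fun x y => ?_
  have h := S.tmul_inV_inV_lie x y v
  simp only [LinearMap.comp_apply, LinearMap.flip_apply, LinearMap.neg_apply]
  rw [← lie_inV, lieTmulBilin_lie_left, lie_inV, lie_inV, lie_inV]
  exact eq_neg_of_add_eq_zero_left h

/-- The inverse of `toProd`. -/
noncomputable def ofProd : (V ⊗[K] V) × S.JacobiQuotient →ₗ[K] LieTensorSquare K L :=
  LinearMap.coprod (TensorProduct.lift ((lieTmulBilin K L).compl₁₂ S.inV S.inV))
    ((LinearMap.range S.alt.jacobiWedge).liftQ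
      (TensorProduct.lift ((lieTmulBilin K L).compl₁₂ S.inV S.inZ)) (by
        rw [AlternatingMap.range_jacobiWedge, Submodule.span_le]
        rintro _ ⟨v, rfl⟩
        rw [SetLike.mem_coe, LinearMap.mem_ker, AlternatingMap.jacobi_apply]
        simpa using S.tmul_inV_inV_lie (v 0) (v 1) (v 2)))

/-- The non-abelian tensor square of `V × Z` is `(V ⊗ V) × (V ⊗ Z) / Jacobi`. -/
noncomputable def tensorSquareEquiv :
    LieTensorSquare K L ≃ₗ[K] (V ⊗[K] V) × S.JacobiQuotient :=
  LinearEquiv.ofLinearMap S.toProd S.ofProd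
    (by
      apply LinearMap.prod_ext
      · apply TensorProduct.ext'
        intro x y
        simp [ofProd, toProd_tmul, pairing_apply, symm_inV]
      · apply Submodule.linearMap_qext
        apply TensorProduct.ext'
        intro x y
        simp [ofProd, toProd_tmul, pairing_apply, symm_inV, symm_inZ])
    (by
      refine lieTensorSquare_linearMap_ext S.lie_lie_eq_zero fun x y => ?_
      rw [LinearMap.comp_apply, S.toProd_tmul]
      conv_rhs => rw [← S.inV_add_inZ x, ← S.inV_add_inZ y]
      simp only [map_add, LinearMap.add_apply, S.tmul_inZ_inZ, S.tmul_inZ_inV, LinearMap.id_apply]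
      simp [ofProd, pairing_apply]
      abel)

theorem tensorSquareEquiv_tmul (x y : L) :
    S.tensorSquareEquiv (lieTmulBilin K L x y) = S.pairing x y :=
  S.toProd_tmul x y

end ClassTwoSplitting

end Splitting

/-! ### Generators -/

section Generators

variable {K L : Type*} [Field K] [LieRing L] [LieAlgebra K L]

/-- In a Lie algebra of class at most two, a subset generates if and only if it generates modulo
the derived algebra. -/
theorem lieSpan_eq_top_iff (hcl : ∀ a b c : L, ⁅a, ⁅b, c⁆⁆ = 0) (s : Set L) :
    LieSubalgebra.lieSpan K L s = ⊤ ↔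
      Submodule.span K s ⊔ Submodule.span K (Set.range fun p : L × L => ⁅p.1, p.2⁆) = ⊤ := by
  set D : Submodule K L := Submodule.span K (Set.range fun p : L × L => ⁅p.1, p.2⁆) with hD
  have hDz : ∀ x : L, ∀ z ∈ D, ⁅x, z⁆ = 0 := by
    intro x z hz
    induction hz using Submodule.span_induction with
    | mem z hz => obtain ⟨p, rfl⟩ := hz; exact hcl _ _ _
    | zero => exact lie_zero _
    | add _ _ _ _ h h' => rw [lie_add, h, h', add_zero]
    | smul _ _ _ h => rw [lie_smul, h, smul_zero]
  constructor
  · intro h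
    let S : LieSubalgebra K L :=
      { Submodule.span K s ⊔ D with
        lie_mem' := fun {x y} _ _ =>
          Submodule.mem_sup_right (Submodule.subset_span ⟨(x, y), rfl⟩) }
    have hS : LieSubalgebra.lieSpan K L s ≤ S :=
      LieSubalgebra.lieSpan_le.2 fun x hx => Submodule.mem_sup_left (Submodule.subset_span hx)
    rw [eq_top_iff]
    intro x _
    exact hS (h ▸ LieSubalgebra.mem_top x)
  · intro h
    have hspan : Submodule.span K s ≤ (LieSubalgebra.lieSpan K L s).toSubmodule :=
      Submodule.span_le.2 LieSubalgebra.subset_lieSpan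
    -- brackets only see the components in `span s`
    have hDle : D ≤ (LieSubalgebra.lieSpan K L s).toSubmodule := by
      rw [hD, Submodule.span_le]
      rintro _ ⟨⟨x, y⟩, rfl⟩
      obtain ⟨a, ha, z, hz, rfl⟩ := Submodule.mem_sup.1 (h ▸ Submodule.mem_top (x := x))
      obtain ⟨b, hb, w, hw, rfl⟩ := Submodule.mem_sup.1 (h ▸ Submodule.mem_top (x := y))
      change ⁅a + z, b + w⁆ ∈ LieSubalgebra.lieSpan K L s
      rw [lie_add, hDz _ w hw, add_lie, ← lie_skew z b, hDz _ z hz, neg_zero, add_zero, add_zero]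
      exact LieSubalgebra.lie_mem _ (hspan ha) (hspan hb)
    rw [eq_top_iff]
    intro x _
    exact (h ▸ sup_le hspan hDle : (⊤ : Submodule K L) ≤ _) Submodule.mem_top

end Generators

/-! ### Dimensions -/

namespace ClassTwoSplitting

variable {K L V Z : Type*} [Field K] [LieRing L] [LieAlgebra K L] [AddCommGroup V] [Module K V]
  [AddCommGroup Z] [Module K Z] (S : ClassTwoSplitting K L V Z)

theorem span_lie :
    Submodule.span K (Set.range fun p : L × L => ⁅p.1, p.2⁆) = LinearMap.range S.inZ := by
  apply le_antisymm
  · rw [Submodule.span_le]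
    rintro _ ⟨p, rfl⟩
    exact ⟨_, (S.lie_eq p.1 p.2).symm⟩
  · rw [LinearMap.range_eq_map, ← S.span_form, Submodule.map_span, Submodule.span_le]
    rintro _ ⟨_, ⟨p, rfl⟩, rfl⟩
    exact Submodule.subset_span ⟨(S.inV p.1, S.inV p.2), S.lie_inV _ _⟩

theorem lieSpan_eq_top_iff (s : Set L) : LieSubalgebra.lieSpan K L s = ⊤ ↔
    Submodule.span K ((fun x => (S.equiv.symm x).1) '' s) = ⊤ := by
  let P : L →ₗ[K] V := LinearMap.fst K V Z ∘ₗ S.equiv.symm.toLinearMap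
  have hP : Function.Surjective P := fun v => ⟨S.inV v, congrArg Prod.fst (S.symm_inV v)⟩
  have hk : LinearMap.ker P = LinearMap.range S.inZ := by
    ext x
    constructor
    · intro hx
      refine ⟨(S.equiv.symm x).2, ?_⟩
      have h0 : (S.equiv.symm x).1 = 0 := hx
      have := S.inV_add_inZ x
      rwa [h0, map_zero, zero_add] at this
    · rintro ⟨z, rfl⟩
      exact congrArg Prod.fst (S.symm_inZ z)
  rw [_root_.lieSpan_eq_top_iff S.lie_lie_eq_zero, S.span_lie, ← hk,
    ← Submodule.comap_map_eq, Submodule.map_span]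
  exact ⟨fun h => Submodule.comap_injective_of_surjective hP (h.trans (Submodule.comap_top P).symm),
    fun h => (congrArg (Submodule.comap P) h).trans (Submodule.comap_top P)⟩

include S in
/-- The number of generators of `L = V × Z` is the dimension of `V`. -/
theorem rank_eq_of_isGeneratedMinimallyBy {d : ℕ} (hd : IsGeneratedMinimallyBy K L d) :
    Module.rank K V = d := by
  classical
  obtain ⟨⟨s, hs, hgen⟩, hmin⟩ := hd
  rw [S.lieSpan_eq_top_iff] at hgen
  have hspan : Submodule.span K (s.image fun x => (S.equiv.symm x).1 : Set V) = ⊤ := by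
    rw [Finset.coe_image, hgen]
  have hfin : FiniteDimensional K V := ⟨⟨_, hspan⟩⟩
  have h1 : Module.finrank K V ≤ d := by
    have h := finrank_span_finset_le_card (R := K) (s.image fun x => (S.equiv.symm x).1)
    rw [Set.finrank, hspan, finrank_top] at h
    exact h.trans (Finset.card_image_le.trans hs.le)
  have h2 : d ≤ Module.finrank K V := by
    let b := Module.finBasis K V
    have hinj : Function.Injective fun i => S.inV (b i) := fun i j hij => b.injective <| by
      simpa [symm_inV] using congrArg S.equiv.symm hij
    refine hmin ⟨Finset.univ.image fun i => S.inV (b i), ?_, ?_⟩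
    · rw [Finset.card_image_of_injective _ hinj, Finset.card_univ, Fintype.card_fin]
    · rw [S.lieSpan_eq_top_iff, Finset.coe_image, Finset.coe_univ, Set.image_univ,
        ← Set.range_comp, ← b.span_eq]
      congr 2
      ext i
      simp [symm_inV]
  rw [← Module.finrank_eq_rank, le_antisymm h1 h2]

include S in
theorem isLieAbelian_tensorSquare : IsLieAbelian (LieTensorSquare K L) :=
  ⟨lieTensorSquare_lie_eq_zero S.lie_lie_eq_zero⟩

/-- The ideal `L □ L` corresponds to the span of the tensors `v ⊗ v`. -/
theorem map_boxSquare :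
    (boxSquare K L).toSubmodule.map S.tensorSquareEquiv.toLinearMap =
      (diagonalTensors K V).prod ⊥ := by
  have hsq : ∀ x : L, S.tensorSquareEquiv (lieTmul K L x x) =
      ((S.equiv.symm x).1 ⊗ₜ (S.equiv.symm x).1, 0) := fun x => by
    rw [← lieTmulBilin_apply, S.tensorSquareEquiv_tmul, S.pairing_apply, sub_self, map_zero]
  apply le_antisymm
  · -- `L ⊗ L` is abelian, so every subspace is an ideal
    let I : LieIdeal K (LieTensorSquare K L) :=
      { ((diagonalTensors K V).prod ⊥).comap S.tensorSquareEquiv.toLinearMap with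
        lie_mem := fun {u v} _ => by
          rw [lieTensorSquare_lie_eq_zero S.lie_lie_eq_zero]
          exact Submodule.zero_mem _ }
    have hI : boxSquare K L ≤ I := by
      refine LieSubmodule.lieSpan_le.2 ?_
      rintro _ ⟨x, rfl⟩
      change S.tensorSquareEquiv (lieTmul K L x x) ∈ (diagonalTensors K V).prod ⊥
      rw [hsq]
      exact ⟨Submodule.subset_span ⟨_, rfl⟩, rfl⟩
    exact Submodule.map_le_iff_le_comap.2 hI
  · rw [← Submodule.map_inl, diagonalTensors, Submodule.map_span, Submodule.span_le]
    rintro _ ⟨_, ⟨v, rfl⟩, rfl⟩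
    refine ⟨lieTmul K L (S.inV v) (S.inV v), LieSubmodule.subset_lieSpan ⟨_, rfl⟩, ?_⟩
    exact (hsq _).trans (by rw [S.symm_inV]; rfl)

variable [FiniteDimensional K V] [FiniteDimensional K Z]

include S in
theorem finite_tensorSquare : FiniteDimensional K (LieTensorSquare K L) :=
  Module.Finite.equiv S.tensorSquareEquiv.symm

theorem finrank_tensorSquare_add :
    Module.finrank K (LieTensorSquare K L) + (Module.finrank K V).choose 3 =
      Module.finrank K V * Module.finrank K V + Module.finrank K V * Module.finrank K Z +
        Module.finrank K (LinearMap.ker S.alt.jacobiWedge) := by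
  have h : Module.finrank K S.JacobiQuotient + (Module.finrank K V).choose 3 =
      Module.finrank K V * Module.finrank K Z +
        Module.finrank K (LinearMap.ker S.alt.jacobiWedge) :=
    finrank_quotient_range_jacobiWedge_add S.alt
  rw [S.tensorSquareEquiv.finrank_eq, Module.finrank_prod, Module.finrank_tensorProduct]
  omega

include S in
theorem finrank_exteriorSquare_add :
    Module.finrank K (LieExteriorSquare K L) + Module.finrank K V * Module.finrank K V =
      Module.finrank K (LieTensorSquare K L) + (Module.finrank K V).choose 2 := by
  have := S.finite_tensorSquare
  have h1 := (boxSquare K L).toSubmodule.finrank_quotient_add_finrank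
  have h2 : Module.finrank K (boxSquare K L).toSubmodule =
      Module.finrank K (diagonalTensors K V) := by
    rw [← LinearEquiv.finrank_map_eq S.tensorSquareEquiv, S.map_boxSquare, ← Submodule.map_inl]
    exact (Submodule.equivMapOfInjective _ LinearMap.inl_injective _).finrank_eq.symm
  have h3 := finrank_diagonalTensors_add (K := K) (V := V)
  have h4 : Module.finrank K (LieExteriorSquare K L) =
    Module.finrank K (LieTensorSquare K L ⧸ (boxSquare K L).toSubmodule) := rfl
  omega

include S in
theorem finrank_J₂_add :
    Module.finrank K (J₂ K L) + Module.finrank K Z = Module.finrank K (LieTensorSquare K L) := by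
  have := S.finite_tensorSquare
  have h1 := (commutatorMap K L : LieTensorSquare K L →ₗ[K] L).finrank_range_add_finrank_ker
  have h2 : LinearMap.range (commutatorMap K L : LieTensorSquare K L →ₗ[K] L) =
      LinearMap.range S.inZ := by
    rw [← S.span_lie, LinearMap.range_eq_map, ← span_lieTmulBilin_eq_top S.lie_lie_eq_zero,
      Submodule.map_span, ← Set.range_comp]
    congr 2
    ext p
    exact commutatorMap_tmul K L p.1 p.2
  have h3 : Function.Injective S.inZ := fun z w h => by
    simpa [symm_inZ] using congrArg S.equiv.symm h
  rw [h2, LinearMap.finrank_range_of_inj h3] at h1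
  have h4 : Module.finrank K (J₂ K L) =
    Module.finrank K (LinearMap.ker (commutatorMap K L : LieTensorSquare K L →ₗ[K] L)) := rfl
  omega

end ClassTwoSplitting

/-! ### Generalized Heisenberg Lie algebras -/

section Main

variable {K L : Type*} [Field K] [LieRing L] [LieAlgebra K L]

/-- A Lie algebra whose derived algebra is its centre splits over a complement of the centre. -/
theorem exists_classTwoSplitting
    (hL : ⁅(⊤ : LieIdeal K L), (⊤ : LieIdeal K L)⁆ = LieAlgebra.center K L) :
    ∃ V : Submodule K L, Nonempty (ClassTwoSplitting K L V
      (⁅(⊤ : LieIdeal K L), (⊤ : LieIdeal K L)⁆ : LieIdeal K L).toSubmodule) := by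
  set Z : Submodule K L := (⁅(⊤ : LieIdeal K L), (⊤ : LieIdeal K L)⁆ : LieIdeal K L).toSubmodule
    with hZ
  have hmem : ∀ x y : L, ⁅x, y⁆ ∈ Z := fun x y =>
    LieSubmodule.lie_mem_lie (LieSubmodule.mem_top x) (LieSubmodule.mem_top y)
  have hcen : ∀ z ∈ Z, ∀ x : L, ⁅x, z⁆ = 0 := by
    intro z hz
    rw [hZ, hL] at hz
    exact (LieModule.mem_maxTrivSubmodule (R := K) (L := L) (M := L) z).1 hz
  have hcen' : ∀ z ∈ Z, ∀ x : L, ⁅z, x⁆ = 0 := fun z hz x => by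
    rw [← lie_skew, hcen z hz, neg_zero]
  obtain ⟨V, hV⟩ := Z.exists_isCompl
  refine ⟨V, ⟨{
    equiv := Submodule.prodEquivOfIsCompl V Z hV.symm
    form := LinearMap.mk₂ K (fun v w => ⟨⁅(v : L), (w : L)⁆, hmem _ _⟩)
      (fun x x' y => Subtype.ext (add_lie _ _ _)) (fun c x y => Subtype.ext (smul_lie _ _ _))
      (fun x y y' => Subtype.ext (lie_add _ _ _)) (fun c x y => Subtype.ext (lie_smul _ _ _))
    form_self := fun v => Subtype.ext (lie_self _)
    span_form := ?_
    lie_equiv := ?_ }⟩⟩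
  · have hgen : Z = Submodule.span K {⁅x, n⁆ | (x ∈ (⊤ : LieIdeal K L)) (n ∈ (⊤ : LieIdeal K L))} :=
      LieSubmodule.lieIdeal_oper_eq_linear_span' ⊤ ⊤
    refine Submodule.map_injective_of_injective Z.injective_subtype ?_
    rw [Submodule.map_span, Submodule.map_subtype_top]
    apply le_antisymm
    · rw [Submodule.span_le]
      rintro _ ⟨z, _, rfl⟩
      exact z.2
    · rw (occs := .pos [1]) [hgen]
      rw [Submodule.span_le]
      rintro _ ⟨x, -, y, -, rfl⟩
      have hdec : ∀ x : L, ∃ v ∈ V, ∃ z ∈ Z, v + z = x := fun x =>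
        Submodule.mem_sup.1 (hV.symm.sup_eq_top ▸ Submodule.mem_top)
      obtain ⟨v, hv, z, hz, rfl⟩ := hdec x
      obtain ⟨w, hw, z', hz', rfl⟩ := hdec y
      refine Submodule.subset_span ⟨_, ⟨(⟨v, hv⟩, ⟨w, hw⟩), rfl⟩, ?_⟩
      change ⁅v, w⁆ = ⁅v + z, w + z'⁆
      rw [lie_add, hcen z' hz', add_lie, hcen' z hz, add_zero, add_zero]
  · rintro ⟨v, z⟩ ⟨w, z'⟩
    simp only [Submodule.coe_prodEquivOfIsCompl']
    rw [lie_add, hcen _ z'.2, add_lie, hcen' _ z.2, add_zero, add_zero]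
    simp

theorem natCast_choose_three (d : ℕ) :
    (d.choose 3 : ℚ) = d * (d - 1) * (d - 2) / 6 := by
  induction d with
  | zero => simp
  | succ d ih =>
    rw [Nat.choose_succ_succ, Nat.cast_add, ih, Nat.cast_choose_two]
    push_cast
    ring

theorem IsAbelianOfDim.of_finrank {M : Type*} [LieRing M] [LieAlgebra K M]
    [FiniteDimensional K M] (h : IsLieAbelian M) {q : ℚ} (hq : (Module.finrank K M : ℚ) = q) :
    IsAbelianOfDim K M q :=
  ⟨h, _, hq, (Module.finrank_eq_rank K M).symm⟩

/-- The three dimensions in terms of the number `d` of generators and the rank `m`, up to the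
dimension `e` of the space of trivectors all of whose slices are relations. -/
theorem exists_dimensions {d m : ℕ}
    (hd : IsGeneratedMinimallyBy K L d) (hL : IsGeneralizedHeisenberg K L m) :
    ∃ e : ℕ, (d.choose 2 ≤ m + 2 → e = 0) ∧ (d.choose 2 ≤ m + 3 → e ≤ 1) ∧
      IsAbelianOfDim K (LieExteriorSquare K L)
        (d * (d - 1) / 2 + d * m - d * (d - 1) * (d - 2) / 6 + e) ∧
      IsAbelianOfDim K (LieTensorSquare K L)
        (d ^ 2 + d * m - d * (d - 1) * (d - 2) / 6 + e) ∧
      IsAbelianOfDim K (J₂ K L)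
        (d ^ 2 + d * m - d * (d - 1) * (d - 2) / 6 + e - m) := by
  obtain ⟨hZ, hm⟩ := hL
  obtain ⟨V, ⟨S⟩⟩ := exists_classTwoSplitting hZ
  have hV := S.rank_eq_of_isGeneratedMinimallyBy hd
  set Z : Submodule K L := (⁅(⊤ : LieIdeal K L), (⊤ : LieIdeal K L)⁆ : LieIdeal K L).toSubmodule
  have hm' : Module.rank K Z = m := hm
  have : FiniteDimensional K V := Module.rank_lt_aleph0_iff.1 (hV ▸ Cardinal.natCast_lt_aleph0)
  have : FiniteDimensional K Z := Module.rank_lt_aleph0_iff.1 (hm' ▸ Cardinal.natCast_lt_aleph0)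
  have hVd : Module.finrank K V = d := Module.finrank_eq_of_rank_eq hV
  have hZm : Module.finrank K Z = m := Module.finrank_eq_of_rank_eq hm'
  have := S.finite_tensorSquare
  have habT := S.isLieAbelian_tensorSquare
  have hker := finrank_ker_wedge_add S.alt
    (LinearMap.wedge_toAlternating_surjective S.form_self S.span_form)
  have hT := S.finrank_tensorSquare_add
  have hE := S.finrank_exteriorSquare_add
  have hJ := S.finrank_J₂_add
  rw [hVd, hZm] at *
  set e := Module.finrank K (LinearMap.ker S.alt.jacobiWedge)
  have hTq : (Module.finrank K (LieTensorSquare K L) : ℚ) =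
      d ^ 2 + d * m - d * (d - 1) * (d - 2) / 6 + e := by
    have : (Module.finrank K (LieTensorSquare K L) : ℚ) + d.choose 3 = d * d + d * m + e := by
      exact_mod_cast hT
    rw [natCast_choose_three] at this
    linear_combination this
  refine ⟨e, fun h => finrank_ker_jacobiWedge_eq_zero (by omega),
    fun h => finrank_ker_jacobiWedge_le_one (by omega), .of_finrank ?_ ?_, .of_finrank habT hTq,
    .of_finrank ?_ ?_⟩
  · refine ⟨fun u v => ?_⟩
    induction u using Submodule.Quotient.induction_on with | H u =>
    induction v using Submodule.Quotient.induction_on with | H v =>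
    exact congrArg (Submodule.Quotient.mk (p := (boxSquare K L).toSubmodule)) (habT.trivial u v)
  · have : (Module.finrank K (LieExteriorSquare K L) : ℚ) + d * d =
        Module.finrank K (LieTensorSquare K L) + d.choose 2 := by exact_mod_cast hE
    rw [hTq, Nat.cast_choose_two] at this
    linear_combination this
  · exact ⟨fun u v => Subtype.ext (habT.trivial (u : LieTensorSquare K L) v)⟩
  · have : (Module.finrank K (J₂ K L) : ℚ) + m = Module.finrank K (LieTensorSquare K L) := by
      exact_mod_cast hJ
    rw [hTq] at this
    linear_combination this

end Main

theorem mainTheorem2 {K L : Type*} [Field K] [LieRing L] [LieAlgebra K L] (d m : ℕ)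
    (hd : IsGeneratedMinimallyBy K L d) (hL : IsGeneralizedHeisenberg K L m) :
    ((m : ℚ) = d * (d - 1) / 2 - 1 →
      IsAbelianOfDim K (LieExteriorSquare K L) ((d - 1) * (2 * d ^ 2 + 5 * d - 6) / 6 - 1) ∧
      IsAbelianOfDim K (LieTensorSquare K L) (d * (d ^ 2 + 3 * d - 4) / 3) ∧
      IsAbelianOfDim K (J₂ K L) ((d + 1) * (2 * d - 3) * (d + 2) / 6 + 2)) ∧
    ((m : ℚ) = d * (d - 1) / 2 - 2 →
      IsAbelianOfDim K (LieExteriorSquare K L) ((d - 1) * (2 * d ^ 2 + 5 * d - 12) / 6 - 2) ∧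
      IsAbelianOfDim K (LieTensorSquare K L) (d * (d ^ 2 + 3 * d - 7) / 3) ∧
      IsAbelianOfDim K (J₂ K L) ((d + 1) * (2 * d ^ 2 + d - 12) / 6 + 4)) ∧
    ((m : ℚ) = d * (d - 1) / 2 - 3 →
      (IsAbelianOfDim K (LieExteriorSquare K L) ((d - 1) * (2 * d ^ 2 + 5 * d - 18) / 6 - 3) ∨
        IsAbelianOfDim K (LieExteriorSquare K L) ((d - 1) * (2 * d ^ 2 + 5 * d - 18) / 6 - 2)) ∧
      (IsAbelianOfDim K (LieTensorSquare K L) (d * (d ^ 2 + 3 * d - 10) / 3) ∨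
        IsAbelianOfDim K (LieTensorSquare K L) (d * (d ^ 2 + 3 * d - 10) / 3 + 1)) ∧
      (IsAbelianOfDim K (J₂ K L) ((d + 1) * (2 * d ^ 2 + d - 18) / 6 + 6) ∨
        IsAbelianOfDim K (J₂ K L) ((d + 1) * (2 * d ^ 2 + d - 18) / 6 + 7))) := by
  obtain ⟨e, he0, he1, hE, hT, hJ⟩ := exists_dimensions hd hL
  have hc := Nat.cast_choose_two ℚ d
  refine ⟨fun h => ?_, fun h => ?_, fun h => ?_⟩
  · have hle : d.choose 2 = m + 1 := by
      have : (d.choose 2 : ℚ) = m + 1 := by rw [hc, h]; ring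
      exact_mod_cast this
    rw [he0 (by omega), h, Nat.cast_zero] at hE hT hJ
    refine ⟨?_, ?_, ?_⟩
    · convert hE using 1; ring
    · convert hT using 1; ring
    · convert hJ using 1; ring
  · have hle : d.choose 2 = m + 2 := by
      have : (d.choose 2 : ℚ) = m + 2 := by rw [hc, h]; ring
      exact_mod_cast this
    rw [he0 (by omega), h, Nat.cast_zero] at hE hT hJ
    refine ⟨?_, ?_, ?_⟩
    · convert hE using 1; ring
    · convert hT using 1; ring
    · convert hJ using 1; ring
  · have hle : d.choose 2 = m + 3 := by
      have : (d.choose 2 : ℚ) = m + 3 := by rw [hc, h]; ring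
      exact_mod_cast this
    rw [h] at hE hT hJ
    obtain rfl | rfl : e = 0 ∨ e = 1 := by have := he1 (by omega); omega
    · rw [Nat.cast_zero] at hE hT hJ
      refine ⟨.inl ?_, .inl ?_, .inl ?_⟩
      · convert hE using 1; ring
      · convert hT using 1; ring
      · convert hJ using 1; ring
    · rw [Nat.cast_one] at hE hT hJ
      refine ⟨.inr ?_, .inr ?_, .inr ?_⟩
      · convert hE using 1; ring
      · convert hT using 1; ring
      · convert hJ using 1; ring
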